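/- Throughout, $(\Omega,\mathscr F,\mathcal P)$ is a probability space (arbitrary otherwise). For an extended real valued function $f$ on $\Omega$, measurable with respect to the $\mathcal P$-completion of $\mathscr F$, say that $\mathbb E\{f\}$ exists if at least one of $\mathbb E\{f^+\},\mathbb E\{f^-\}$ is finite, and then $\mathbb E\{f\}=\mathbb E\{f^+\}-\mathbb E\{f^-\}\in[-\infty,+\infty]$. If $\mathbb E\{f\}$ exists and $\mathscr G\subseteq\mathscr F$ is a $\sigma$-algebra, a version of $\mathbb E\{f|\mathscr G\}$ is a $\mathscr G$-measurable $\varphi:\Omega\to\overline{\mathbb R}$ such that $\int_A\varphi\,d\mathcal P$ exists and equals $\int_A f\,d\mathcal P$ for every $A\in\mathscr G$. Let $Y:\Omega\to\mathbb R^M$ be a random vector and $\mathscr Y=\sigma\{Y\}$. Let $g:\Omega\times\mathbb R^N\to\mathbb R$ be such that $\mathbb E\{g(\cdot,x)\}$ exists for all $x\in\mathbb R^N$, and for every $x\in\mathbb R^N$ let a version $\omega\mapsto\mathbb E\{g(\cdot,x)|\mathscr Y\}(\omega)$ of the conditional expectation be fixed. Let $\mathcal X:\mathbb R^N\rightrightarrows\mathbb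 R^N$ be a multifunction with closed nonempty values, which is Borel measurable, that is, $\{z:\mathcal X(z)\cap A\ne\varnothing\}$ is a Borel set for every closed $A\subseteq\mathbb R^N$. Let $Z_Y=\mathcal Z(Y)$ for some Borel $\mathcal Z:\mathbb R^M\to\mathbb R^N$, and let $\mathcal F$ be the set of all $\mathscr Y$-measurable $X:\Omega\to\mathbb R^N$ with $X(\omega)\in\mathcal X(Z_Y(\omega))$ for $\mathcal P$-almost every $\omega$. Then $\mathcal F$ is nonempty. Suppose moreover that (1) $\mathbb E\{g(\cdot,X)\}$ exists for all $X\in\mathcal F$, and $\inf_{X\in\mathcal F}\mathbb E\{g(\cdot,X)\}<+\infty$; (2) $g$ has the Substitution Property within $\mathcal F$: there is a jointly Borel measurable $h:\mathbb R^M\times\mathbb R^N\to\overline{\mathbb R}$ with $h(Y(\omega),x)=\mathbb E\{g(\cdot,x)|\mathscr Y\}(\omega)$ for all $(\omega,x)\in\Omega\times\mathbb R^N$ (for the fixed versions), such that for every $X\in\mathcal F$ one has $\mathbb E\{g(\cdot,X)|\mathscr Y\}(\omega)=h(Y(\omega),X(\omega))$ for $\mathcal P$-almost every $\omega$ (the exceptional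 null set may depend on $X$). Then the pointwise optimal value $$\vartheta(\omega)=\inf_{x\in\mathcal X(Z_Y(\omega))}\mathbb E\{g(\cdot,x)|\mathscr Y\}(\omega)$$ is measurable with respect to the completion of $\mathscr Y$ relative to $\mathcal P|_{\mathscr Y}$, its expectation exists, and $$\inf_{X\in\mathcal F}\mathbb E\{g(\cdot,X)\}=\mathbb E\{\vartheta\}.$$ In words, minimization and expectation may be interchanged. -/

import Mathlib

open MeasureTheory
open scoped ENNReal

namespace FundLemma

noncomputable section

/-- The expectation `E f = E f⁺ - E f⁻` of an extended real valued function. It is only meaningful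
when `ExpectationExists μ f` holds. -/
def expectation {Ω : Type*} {mΩ : MeasurableSpace Ω} (μ : Measure Ω) (f : Ω → EReal) : EReal :=
  ((∫⁻ ω, (f ω).toENNReal ∂μ : ℝ≥0∞) : EReal) - ((∫⁻ ω, (-f ω).toENNReal ∂μ : ℝ≥0∞) : EReal)

/-- `E f` exists (possibly with an infinite value): `f` is measurable for the `μ`-completion of the
underlying σ-algebra (on a complete space this is ordinary measurability), and at least one of
`E f⁺`, `E f⁻` is finite. -/
def ExpectationExists {Ω : Type*} {mΩ : MeasurableSpace Ω} (μ : Measure Ω) (f : Ω → EReal) : Prop :=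
  AEMeasurable f μ ∧
    ((∫⁻ ω, (f ω).toENNReal ∂μ) ≠ ∞ ∨ (∫⁻ ω, (-f ω).toENNReal ∂μ) ≠ ∞)

/-- `φ` is a version of the conditional expectation `E {f | m}`, for a function `f` whose
expectation exists (it need not be integrable): `φ` is an extended real valued `m`-measurable
function with `∫_A φ = ∫_A f` for every `A ∈ m`, the integrals being well defined. -/
structure IsCondExp {Ω : Type*} (m : MeasurableSpace Ω) {mΩ : MeasurableSpace Ω} (μ : Measure Ω)
    (f φ : Ω → EReal) : Prop where
  exists_expectation : ExpectationExists μ f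
  measurable : Measurable[m] φ
  exists_setExpectation : ∀ A : Set Ω, MeasurableSet[m] A → ExpectationExists (μ.restrict A) φ
  setExpectation_eq : ∀ A : Set Ω, MeasurableSet[m] A →
    expectation (μ.restrict A) φ = expectation (μ.restrict A) f

/-- The σ-algebra `σ(Y)` generated by `Y`. -/
abbrev sigmaAlg {Ω : Type*} {M : ℕ} (Y : Ω → EuclideanSpace ℝ (Fin M)) : MeasurableSpace Ω :=
  MeasurableSpace.comap Y inferInstance

/-- The domain of a multifunction. -/
def multiDom {S T : Type*} (𝒳 : S → Set T) : Set S := {z | (𝒳 z).Nonempty}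

/-- Measurability of a closed-valued multifunction: preimages of closed sets are measurable. -/
def MeasurableMulti {S T : Type*} [MeasurableSpace S] [TopologicalSpace T] (𝒳 : S → Set T) : Prop :=
  ∀ A : Set T, IsClosed A → MeasurableSet {z | (𝒳 z ∩ A).Nonempty}

/-- The class `ℑ` of all `σ(Y)`-measurable `X : Ω → ℝ^N` for which `E {g(·, X)}` exists. -/
def admissible {Ω : Type*} {mΩ : MeasurableSpace Ω} (μ : Measure Ω) {M N : ℕ}
    (Y : Ω → EuclideanSpace ℝ (Fin M)) (g : Ω → EuclideanSpace ℝ (Fin N) → ℝ) :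
    Set (Ω → EuclideanSpace ℝ (Fin N)) :=
  {X | Measurable[sigmaAlg Y] X ∧ ExpectationExists μ (fun ω => (g ω (X ω) : EReal))}

/-- The Substitution Property of `g` within the class `C`. Here `ce ω x` is the value at `ω` of
the version of `E {g(·, x) | σ(Y)}` that is in use. Since `h (Y, X)` is `σ(Y)`-measurable, it agrees
almost everywhere with `E {g(·, X) | σ(Y)}` if and only if it is itself a version of it. -/
def SubstitutionProperty {Ω : Type*} {mΩ : MeasurableSpace Ω} (μ : Measure Ω) {M N : ℕ}
    (Y : Ω → EuclideanSpace ℝ (Fin M)) (g : Ω → EuclideanSpace ℝ (Fin N) → ℝ)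
    (ce : Ω → EuclideanSpace ℝ (Fin N) → EReal)
    (C : Set (Ω → EuclideanSpace ℝ (Fin N))) : Prop :=
  C ⊆ admissible μ Y g ∧
    ∃ h : EuclideanSpace ℝ (Fin M) × EuclideanSpace ℝ (Fin N) → EReal,
      Measurable h ∧
      (∀ ω x, h (Y ω, x) = ce ω x) ∧
      ∀ X ∈ C, IsCondExp (sigmaAlg Y) μ (fun ω => (g ω (X ω) : EReal)) (fun ω => h (Y ω, X ω))

/-- The decision set: all `σ(Y)`-measurable functions that are almost everywhere selections of the
random multifunction `ω ↦ 𝒳 (Z ω)`. -/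
def decisionSet {Ω : Type*} {mΩ : MeasurableSpace Ω} (μ : Measure Ω) {M N : ℕ}
    (Y : Ω → EuclideanSpace ℝ (Fin M))
    (𝒳 : EuclideanSpace ℝ (Fin N) → Set (EuclideanSpace ℝ (Fin N)))
    (Z : Ω → EuclideanSpace ℝ (Fin N)) : Set (Ω → EuclideanSpace ℝ (Fin N)) :=
  {X | (∀ᵐ ω ∂μ, X ω ∈ 𝒳 (Z ω)) ∧ Measurable[sigmaAlg Y] X}

/-- The pointwise optimal value `ϑ(ω) = inf_{x ∈ 𝒳(Z(ω))} E {g(·, x) | σ(Y)}(ω)`, where `ce ω x` is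
the value at `ω` of the version of `E {g(·, x) | σ(Y)}` that is in use. -/
def optimalValue {Ω : Type*} {N : ℕ} (ce : Ω → EuclideanSpace ℝ (Fin N) → EReal)
    (𝒳 : EuclideanSpace ℝ (Fin N) → Set (EuclideanSpace ℝ (Fin N)))
    (Z : Ω → EuclideanSpace ℝ (Fin N)) : Ω → EReal :=
  fun ω => ⨅ x ∈ 𝒳 (Z ω), ce ω x

end

end FundLemma

/-! By the Substitution Property, `g(·, X)` and `h(Y, X)` have the same expectation for every
decision `X`, and `ϑ = θ ∘ Y` with `θ y` the infimum of `h (y, ·)` over `𝒳 (𝒵 y)`. Since `h(Y, X) ≥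
ϑ` almost everywhere, `E ϑ` is a lower bound. Conversely, a Borel `s` with `s y ∈ 𝒳 (𝒵 y)` and `h
(y, s y)` just above `θ y`, for almost every `y`, gives a decision `s ∘ Y` of nearly optimal cost
(`le_expectation_of_le_expectation_upperApprox` is the limit).

Such an `s`, and the measurability of `θ`, come from `exists_measurable_ae_selection`. A Borel set
is a continuous image of the Baire space; up to small measure its projection is the image of a
compact set, where a Borel section exists because compact metrizable spaces are images of the
linearly ordered Cantor set. -/

namespace FundLemma

open Filter Topology Set

/-! ### Capacitability of analytic sets -/

/-- The points of the Baire space whose first `k` coordinates are bounded by those of `b`. -/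
def boundedPrefix (b : ℕ → ℕ) (k : ℕ) : Set (ℕ → ℕ) := {x | ∀ i < k, x i ≤ b i}

/-- An open set containing a compact box of the Baire space contains a finite-dimensional box. -/
lemma exists_boundedPrefix_subset {O : Set (ℕ → ℕ)} (hO : IsOpen O) (b : ℕ → ℕ)
    (h : Set.pi univ (fun i => Iic (b i)) ⊆ O) : ∃ k, boundedPrefix b k ⊆ O := by
  by_contra! hcon
  simp only [not_subset] at hcon
  choose y hy hyO using hcon
  have hK : IsCompact (Set.pi univ (fun i => Iic (b i))) :=
    isCompact_univ_pi fun i => (finite_Iic (b i)).isCompact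
  -- Truncating `y k` after its bounded coordinates puts it in the compact box; each coordinate is
  -- eventually unchanged, so a convergent subsequence of `x` forces the same limit on `y`.
  let x : ℕ → ℕ → ℕ := fun k i => if i < k then y k i else 0
  have hx : ∀ k, x k ∈ Set.pi univ (fun i => Iic (b i)) := by
    intro k i _
    by_cases hi : i < k
    · simpa [x, hi] using hy k i hi
    · simp [x, hi]
  obtain ⟨z, hz, φ, hφ, hlim⟩ := hK.tendsto_subseq hx
  have hlim' : Tendsto (fun n => y (φ n)) atTop (𝓝 z) := by
    rw [tendsto_pi_nhds] at hlim ⊢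
    intro i
    refine (hlim i).congr' ?_
    filter_upwards [eventually_gt_atTop i] with n hn
    simp [x, hn.trans_le (hφ.id_le n)]
  obtain ⟨n, hn⟩ := (hlim'.eventually (hO.mem_nhds (h hz))).exists
  exact hyO _ hn

/-- Choquet capacitability of continuous images of the Baire space. -/
theorem exists_isCompact_le_measure_image {E : Type*} [TopologicalSpace E] [MeasurableSpace E]
    (ν : Measure E) [ν.OuterRegular] {p : (ℕ → ℕ) → E} (hp : Continuous p)
    {c : ℝ≥0∞} (hc : c < ν (range p)) : ∃ K, IsCompact K ∧ c ≤ ν (p '' K) := by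
  have step : ∀ (k : ℕ) (U : Set (ℕ → ℕ)), c < ν (p '' U) →
      ∃ m, c < ν (p '' (U ∩ {x | x k ≤ m})) := by
    intro k U hU
    have hUn : p '' U = ⋃ m, p '' (U ∩ {x | x k ≤ m}) := by
      rw [← image_iUnion, ← inter_iUnion]
      congr 1
      refine (inter_eq_left.2 fun x _ => ?_).symm
      exact mem_iUnion.2 ⟨x k, le_refl (x k)⟩
    have hmono : Monotone fun m : ℕ => p '' (U ∩ {x | x k ≤ m}) := fun m n hmn =>
      image_mono (inter_subset_inter_right _ fun x (hx : x k ≤ m) => hx.trans hmn)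
    -- Continuity from below needs no measurability of the images.
    rw [hUn, hmono.measure_iUnion] at hU
    exact lt_iSup_iff.1 hU
  choose! m hm using step
  let U : ℕ → Set (ℕ → ℕ) := fun k => Nat.rec univ (fun i V => V ∩ {x | x i ≤ m i V}) k
  have hU : ∀ k, c < ν (p '' U k) := by
    intro k
    induction k with
    | zero => simpa [U] using hc
    | succ k ih => exact hm k (U k) ih
  let b : ℕ → ℕ := fun i => m i (U i)
  have hUb : ∀ k, U k = boundedPrefix b k := by
    intro k
    induction k with
    | zero => ext; simp [U, boundedPrefix]
    | succ k ih =>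
      change U k ∩ {x | x k ≤ b k} = _
      rw [ih]
      ext x
      simp only [boundedPrefix, mem_inter_iff, mem_ofPred_eq, Nat.lt_succ_iff_lt_or_eq]
      exact ⟨fun h i hi => hi.elim (h.1 i) fun e => e ▸ h.2,
        fun h => ⟨fun i hi => h i (.inl hi), h k (.inr rfl)⟩⟩
  refine ⟨Set.pi univ fun i => Iic (b i), isCompact_univ_pi fun i => (finite_Iic _).isCompact, ?_⟩
  -- Continuity from above is unavailable for the images of `U k`. Instead, every open set
  -- containing the image of the box already contains the image of some `U k`.
  rw [Set.measure_eq_iInf_isOpen]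
  refine le_iInf fun V => le_iInf fun hV => le_iInf fun hVo => ?_
  obtain ⟨k, hk⟩ := exists_boundedPrefix_subset (hVo.preimage hp) b (image_subset_iff.1 hV)
  exact ((hU k).trans_le (measure_mono (image_subset_iff.2 ((hUb k).trans_subset hk)))).le

/-! ### Measurable sections and selections -/

/-- A continuous map admits a Borel section over the image of a compact metrizable set. -/
theorem exists_measurable_section_of_isCompact {X E : Type*} [TopologicalSpace X]
    [TopologicalSpace.MetrizableSpace X] [MeasurableSpace X] [BorelSpace X] [Nonempty X]
    [TopologicalSpace E] [T2Space E] [MeasurableSpace E] [BorelSpace E]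
    {p : X → E} (hp : Continuous p) {K : Set X} (hK : IsCompact K) :
    ∃ s : E → X, Measurable s ∧ ∀ y ∈ p '' K, p (s y) = y := by
  rcases K.eq_empty_or_nonempty with rfl | hne
  · exact ⟨fun _ => Classical.arbitrary X, measurable_const, by simp⟩
  let _ := TopologicalSpace.metrizableSpaceMetric X
  have : Nonempty K := hne.to_subtype
  have : CompactSpace K := isCompact_iff_compactSpace.1 hK
  obtain ⟨f, hf, hfs⟩ := exists_nat_bool_continuous_surjective_of_compact K
  let r : cantorSet → X := fun t => f (cantorSetHomeomorphNatToBool t)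
  have hr : Continuous r :=
    continuous_subtype_val.comp (hf.comp cantorSetHomeomorphNatToBool.continuous)
  have : CompactSpace cantorSet := isCompact_iff_compactSpace.1 isCompact_cantorSet
  have hrange : ∀ y ∈ p '' K, ∃ t, p (r t) = y := by
    rintro y ⟨x, hx, rfl⟩
    obtain ⟨u, hu⟩ := hfs ⟨x, hx⟩
    exact ⟨cantorSetHomeomorphNatToBool.symm u, by simp [r, hu]⟩
  -- The order of the Cantor set singles out one point of each compact fibre: the least.
  have hmin : ∀ y ∈ p '' K, ∃ t, p (r t) = y ∧ ∀ t', p (r t') = y → t ≤ t' := by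
    intro y hy
    have hc : IsCompact {t | p (r t) = y} :=
      (isClosed_singleton.preimage (hp.comp hr)).isCompact
    obtain ⟨t, ht, hle⟩ := hc.exists_isLeast (hrange y hy)
    exact ⟨t, ht, fun t' h' => hle h'⟩
  have h0 : (0 : ℝ) ∈ cantorSet := zero_mem_cantorSet
  have hK' : IsClosed (p '' K) := (hK.image hp).isClosed
  classical
  choose! t ht htmin using hmin
  let τ : E → cantorSet := fun y => if hy : y ∈ p '' K then t y hy else ⟨0, h0⟩
  have hτ : Measurable τ := by
    refine (MeasurableEmbedding.subtype_coe isClosed_cantorSet.measurableSet).measurable_comp_iff.1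
      (measurable_of_Iic fun c => ?_)
    -- The least parameter is at most `c` iff some parameter is, so the sublevel set is a compact
    -- image, plus the complement of `p '' K` when the default `0` is at most `c`.
    have hset : ((↑) ∘ τ : E → ℝ) ⁻¹' Iic c =
        (fun u => p (r u)) '' {u | (u : ℝ) ≤ c} ∪ ((p '' K)ᶜ ∩ {_y | 0 ≤ c}) := by
      ext y
      by_cases hy : y ∈ p '' K
      · have hτy : τ y = t y hy := dif_pos hy
        simp only [mem_preimage, Function.comp_apply, hτy, mem_Iic, mem_union, mem_inter_iff,
          mem_compl_iff, hy, not_true_eq_false, false_and, or_false]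
        exact ⟨fun h => ⟨t y hy, h, ht y hy⟩,
          fun ⟨u, hu, hue⟩ => (Subtype.coe_le_coe.2 (htmin y hy u hue)).trans hu⟩
      · have hτy : τ y = ⟨0, h0⟩ := dif_neg hy
        have hno : y ∉ (fun u => p (r u)) '' {u | (u : ℝ) ≤ c} := by
          rintro ⟨u, -, rfl⟩
          exact hy ⟨r u, Subtype.property _, rfl⟩
        simp only [mem_preimage, Function.comp_apply, hτy, mem_Iic, mem_union, mem_inter_iff,
          mem_compl_iff, hy, not_false_eq_true, true_and, hno, false_or, mem_ofPred_eq]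
    rw [hset]
    refine MeasurableSet.union ?_ (hK'.measurableSet.compl.inter (MeasurableSet.const _))
    have hcl : IsClosed {u : cantorSet | (u : ℝ) ≤ c} :=
      isClosed_le continuous_subtype_val continuous_const
    exact (hcl.isCompact.image (hp.comp hr)).isClosed.measurableSet
  refine ⟨fun y => r (τ y), hr.measurable.comp hτ, fun y hy => ?_⟩
  simpa only [τ, dif_pos hy] using ht y hy

/-- **Jankov–von Neumann**: a continuous map on the Baire space has a Borel section over almost
every point of its range. -/
theorem exists_measurable_ae_section {E : Type*} [TopologicalSpace E] [T2Space E]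
    [MeasurableSpace E] [BorelSpace E] [MeasurableEq E]
    (ν : Measure E) [IsFiniteMeasure ν] [ν.OuterRegular] {p : (ℕ → ℕ) → E} (hp : Continuous p) :
    ∃ s : E → ℕ → ℕ, Measurable s ∧ ∀ᵐ y ∂ν, y ∈ range p → p (s y) = y := by
  classical
  have key : ∀ n : ℕ, ∃ s : E → ℕ → ℕ, Measurable s ∧
      ν {y | y ∈ range p ∧ p (s y) ≠ y} ≤ ((n : ℝ≥0∞) + 1)⁻¹ := by
    intro n
    set ε : ℝ≥0∞ := ((n : ℝ≥0∞) + 1)⁻¹ with hε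
    have hε0 : ε ≠ 0 := by simp [hε]
    obtain ⟨K, hK, hle⟩ : ∃ K, IsCompact K ∧ ν (range p) - ε ≤ ν (p '' K) := by
      rcases eq_or_ne (ν (range p)) 0 with h0 | h0
      · exact ⟨∅, isCompact_empty, by simp [h0]⟩
      · exact exists_isCompact_le_measure_image ν hp
          (ENNReal.sub_lt_self (measure_ne_top _ _) h0 hε0)
    obtain ⟨s, hs, hsK⟩ := exists_measurable_section_of_isCompact hp hK
    refine ⟨s, hs, ?_⟩
    have hsub : {y | y ∈ range p ∧ p (s y) ≠ y} ⊆ range p \ p '' K :=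
      fun y hy => ⟨hy.1, fun h => hy.2 (hsK y h)⟩
    refine (measure_mono hsub).trans ?_
    rw [measure_sdiff (image_subset_range _ _)
      (hK.image hp).isClosed.measurableSet.nullMeasurableSet (measure_ne_top _ _)]
    exact tsub_le_iff_right.2 (by rw [add_comm]; exact tsub_le_iff_right.1 hle)
  choose s hs hsν using key
  have hmeas : ∀ n, MeasurableSet {y | p (s n y) = y} := fun n =>
    measurableSet_eq_fun (hp.measurable.comp (hs n)) measurable_id
  -- The second alternative makes the search total; it matters only off the range and on a set of
  -- measure at most `1/(n+1)` for every `n`.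
  let Q : ℕ → E → Prop := fun n y => p (s n y) = y ∨ ∀ m, p (s m y) ≠ y
  have hQ : ∀ y, ∃ n, Q n y := by
    intro y
    by_cases h : ∃ n, p (s n y) = y
    · exact h.imp fun n hn => .inl hn
    · exact ⟨0, .inr (not_exists.1 h)⟩
  have hQm : ∀ n, MeasurableSet {y | Q n y} := fun n =>
    (hmeas n).union (measurableSet_setOfPred.2 (Measurable.forall fun m => (hmeas m).compl.mem))
  refine ⟨fun y => s (Nat.find (hQ y)) y, Measurable.find hs hQm hQ, ?_⟩
  have hnull : ν {y | y ∈ range p ∧ ∀ n, p (s n y) ≠ y} = 0 := by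
    refine le_antisymm (ge_of_tendsto' (ENNReal.tendsto_inv_nat_nhds_zero.comp
      (tendsto_add_atTop_nat 1)) fun n => ?_) zero_le
    refine (measure_mono fun y hy => ?_).trans ((hsν n).trans_eq (by simp))
    exact ⟨hy.1, hy.2 n⟩
  rw [← compl_mem_ae_iff] at hnull
  filter_upwards [hnull] with y hy hyr
  rcases Nat.find_spec (hQ y) with h | h
  · exact h
  · exact absurd ⟨hyr, h⟩ hy

/-- Almost everywhere measurable selection from a Borel set in a product. -/
theorem exists_measurable_ae_selection {E F : Type*} [TopologicalSpace E] [PolishSpace E]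
    [MeasurableSpace E] [BorelSpace E] [TopologicalSpace F] [PolishSpace F] [MeasurableSpace F]
    [BorelSpace F] [Nonempty F] (ν : Measure E) [IsFiniteMeasure ν] {B : Set (E × F)}
    (hB : MeasurableSet B) :
    ∃ s : E → F, Measurable s ∧ ∀ᵐ y ∂ν, (∃ x, (y, x) ∈ B) → (y, s y) ∈ B := by
  rcases B.eq_empty_or_nonempty with rfl | hne
  · exact ⟨fun _ => Classical.arbitrary F, measurable_const, by simp⟩
  have hA := hB.analyticSet
  rw [AnalyticSet] at hA
  obtain h | ⟨f, hf, hfB⟩ := hA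
  · exact absurd h hne.ne_empty
  let _ := TopologicalSpace.upgradeIsCompletelyMetrizable E
  -- A section of the first coordinate of a parametrization of `B` lands in `B` over the given
  -- point; its second coordinate is the selection.
  obtain ⟨s, hs, hsν⟩ := exists_measurable_ae_section ν (continuous_fst.comp hf)
  refine ⟨fun y => (f (s y)).2, (continuous_snd.comp hf).measurable.comp hs, ?_⟩
  filter_upwards [hsν] with y hy hex
  obtain ⟨x, hx⟩ := hex
  rw [← hfB] at hx
  obtain ⟨u, hu⟩ := hx
  have h1 : (f (s y)).1 = y := hy ⟨u, by simp [hu]⟩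
  have : (y, (f (s y)).2) = f (s y) := Prod.ext h1.symm rfl
  rw [this, ← hfB]
  exact mem_range_self _

/-- The projection of a Borel set is universally measurable. -/
theorem nullMeasurableSet_exists {E F : Type*} [TopologicalSpace E] [PolishSpace E]
    [MeasurableSpace E] [BorelSpace E] [TopologicalSpace F] [PolishSpace F] [MeasurableSpace F]
    [BorelSpace F] [Nonempty F] (ν : Measure E) [IsFiniteMeasure ν] {B : Set (E × F)}
    (hB : MeasurableSet B) : NullMeasurableSet {y | ∃ x, (y, x) ∈ B} ν := by
  obtain ⟨s, hs, hsν⟩ := exists_measurable_ae_selection ν hB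
  refine ((measurable_id.prodMk hs) hB).nullMeasurableSet.congr ?_
  filter_upwards [hsν] with y hy
  exact propext ⟨fun h => ⟨_, h⟩, hy⟩

/-! ### Measurable graphs and marginal infima -/

/-- The graph of a measurable closed-valued multifunction is measurable. -/
theorem MeasurableMulti.measurableSet_graph {S T : Type*} [MeasurableSpace S] [PseudoMetricSpace T]
    [SecondCountableTopology T] [MeasurableSpace T] [OpensMeasurableSpace T] {𝒳 : S → Set T}
    (hm : MeasurableMulti 𝒳) (hc : ∀ z, IsClosed (𝒳 z)) :
    MeasurableSet {q : S × T | q.2 ∈ 𝒳 q.1} := by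
  rcases isEmpty_or_nonempty T with hT | hT
  · exact (Set.eq_empty_of_isEmpty {q : S × T | q.2 ∈ 𝒳 q.1}) ▸ MeasurableSet.empty
  let D : ℕ → ℕ → Set T := fun i n =>
    Metric.closedBall (TopologicalSpace.denseSeq T i) (1 / ((n : ℝ) + 1))
  -- A point off the closed set `𝒳 z` lies in one of countably many closed balls missing `𝒳 z`. The
  -- radius is below `ε / 2` because two points of a ball can be two radii apart.
  have hcompl : {q : S × T | q.2 ∈ 𝒳 q.1}ᶜ =
      ⋃ i, ⋃ n, {z | (𝒳 z ∩ D i n).Nonempty}ᶜ ×ˢ D i n := by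
    ext ⟨z, x⟩
    simp only [mem_compl_iff, mem_ofPred_eq, mem_iUnion, mem_prod]
    constructor
    · intro hx
      obtain ⟨ε, hε, hball⟩ := Metric.isOpen_iff.1 (hc z).isOpen_compl x hx
      obtain ⟨n, hn⟩ := exists_nat_one_div_lt (half_pos hε)
      obtain ⟨i, hi⟩ := (TopologicalSpace.denseRange_denseSeq T).exists_dist_lt x
        (Nat.one_div_pos_of_nat (α := ℝ) (n := n))
      refine ⟨i, n, ?_, Metric.mem_closedBall.2 hi.le⟩
      rintro ⟨w, hw, hwD⟩
      refine hball (Metric.mem_ball.2 ?_) hw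
      have := dist_triangle_right w x (TopologicalSpace.denseSeq T i)
      have := Metric.mem_closedBall.1 hwD
      linarith
    · rintro ⟨i, n, hne, hx⟩ hmem
      exact hne ⟨x, hmem, hx⟩
  rw [← MeasurableSet.compl_iff, hcompl]
  exact MeasurableSet.iUnion fun i => MeasurableSet.iUnion fun n =>
    (hm _ Metric.isClosed_closedBall).compl.prod Metric.isClosed_closedBall.measurableSet

/-- The marginal infimum of a Borel function over a multifunction with Borel graph is universally
measurable. -/
theorem nullMeasurable_biInf {E F : Type*} [TopologicalSpace E] [PolishSpace E]
    [MeasurableSpace E] [BorelSpace E] [TopologicalSpace F] [PolishSpace F] [MeasurableSpace F]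
    [BorelSpace F] [Nonempty F] (ν : Measure E) [IsFiniteMeasure ν] {K : E → Set F}
    (hK : MeasurableSet {q : E × F | q.2 ∈ K q.1}) {h : E × F → EReal} (hh : Measurable h) :
    NullMeasurable (fun y => ⨅ x ∈ K y, h (y, x)) ν := by
  refine @measurable_of_Iio EReal (NullMeasurableSpace E ν) _ _ _ _ _ _ _ _ fun c => ?_
  -- A strict sublevel set of the infimum is the projection of a Borel set.
  have := nullMeasurableSet_exists ν (hK.inter (hh measurableSet_Iio : MeasurableSet (h ⁻¹' Iio c)))
  refine (congrArg (NullMeasurableSet · ν) ?_).mp this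
  ext y
  change (∃ x, (y, x) ∈ _) ↔ ⨅ x ∈ K y, h (y, x) < c
  simp [iInf_lt_iff]

/-! ### Completions and extended real expectations -/

/-- Preimages under `Y` of null sets for the law of `Y` are null for the trimmed measure, so
measurability is obtained for the completion of `m`, not merely that of the ambient σ-algebra. -/
lemma nullMeasurable_comp_trim {Ω E β : Type*} {m mΩ : MeasurableSpace Ω} [MeasurableSpace E]
    [MeasurableSpace β] (P : Measure Ω) (hm : m ≤ mΩ) {Y : Ω → E} (hY : Measurable[m] Y)
    {θ : E → β} (hθ : NullMeasurable θ (P.map Y)) :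
    @NullMeasurable Ω β m _ (θ ∘ Y) (P.trim hm) := by
  have hq : @Measure.QuasiMeasurePreserving Ω E _ m Y (P.trim hm) (P.map Y) := by
    refine ⟨hY, Measure.AbsolutelyContinuous.mk fun s hs h0 => ?_⟩
    rw [Measure.map_apply hY hs, trim_measurableSet_eq hm (hY hs)]
    rwa [Measure.map_apply (hY.mono hm le_rfl) hs] at h0
  exact fun s hs => (hθ hs).preimage hq

/-- Subtraction on `EReal` is monotone even at `⊤ - ⊤`, so neither expectation has to exist. -/
lemma expectation_mono_ae {Ω : Type*} {mΩ : MeasurableSpace Ω} {μ : Measure Ω} {f f' : Ω → EReal}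
    (hle : ∀ᵐ ω ∂μ, f ω ≤ f' ω) : expectation μ f ≤ expectation μ f' := by
  refine EReal.sub_le_sub (EReal.coe_ennreal_le_coe_ennreal_iff.2 (lintegral_mono_ae ?_))
    (EReal.coe_ennreal_le_coe_ennreal_iff.2 (lintegral_mono_ae ?_))
  · filter_upwards [hle] with ω h using EReal.toENNReal_le_toENNReal h
  · filter_upwards [hle] with ω h using EReal.toENNReal_le_toENNReal (EReal.neg_le_neg_iff.2 h)

lemma lintegral_toENNReal_ne_top_of_expectation_lt_top {Ω : Type*} {mΩ : MeasurableSpace Ω}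
    {μ : Measure Ω} {f : Ω → EReal} (hf : ExpectationExists μ f) (hlt : expectation μ f < ⊤) :
    ∫⁻ ω, (f ω).toENNReal ∂μ ≠ ∞ := by
  rcases hf.2 with h | h
  · exact h
  · intro htop
    rw [expectation, htop] at hlt
    lift (∫⁻ ω, (-f ω).toENNReal ∂μ) to NNReal using h with a
    exact hlt.ne (EReal.top_sub_coe a)

/-- A strict upper bound for `a < ⊤`, which decreases to `a` as `n` grows. -/
noncomputable def upperApprox (n : ℕ) (a : EReal) : EReal :=
  -- The floor `-n` serves `a = ⊥`, which no finite increment moves.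
  max (a + ((1 / ((n : ℝ) + 1) : ℝ) : EReal)) ((-(n : ℝ) : ℝ) : EReal)

lemma measurable_upperApprox (n : ℕ) : Measurable (upperApprox n) :=
  (measurable_id.add_const _).max measurable_const

lemma lt_upperApprox (n : ℕ) {a : EReal} (ha : a < ⊤) : a < upperApprox n a := by
  induction a with
  | bot => exact lt_max_of_lt_right (EReal.bot_lt_coe _)
  | top => exact absurd ha (lt_irrefl _)
  | coe a =>
    refine lt_max_of_lt_left ?_
    rw [← EReal.coe_add]
    exact EReal.coe_lt_coe_iff.2 (lt_add_of_pos_right _ Nat.one_div_pos_of_nat)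

lemma antitone_upperApprox (a : EReal) : Antitone fun n => upperApprox n a := fun _ _ hmn =>
  max_le_max (add_le_add le_rfl (EReal.coe_le_coe_iff.2 (Nat.one_div_le_one_div hmn)))
    (EReal.coe_le_coe_iff.2 (neg_le_neg (Nat.cast_le.2 hmn)))

lemma tendsto_upperApprox (a : EReal) : Tendsto (fun n => upperApprox n a) atTop (𝓝 a) := by
  have h1 : Tendsto (fun n : ℕ => a + ((1 / ((n : ℝ) + 1) : ℝ) : EReal)) atTop (𝓝 (a + 0)) :=
    (EReal.continuousAt_add (p := (a, 0)) (by simp) (by simp)).tendsto.comp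
      (tendsto_const_nhds.prodMk_nhds
        (EReal.tendsto_coe.2 (tendsto_one_div_add_atTop_nhds_zero_nat (𝕜 := ℝ))))
  have h2 : Tendsto (fun n : ℕ => ((-(n : ℝ) : ℝ) : EReal)) atTop (𝓝 ⊥) :=
    EReal.tendsto_coe_atBot.comp (tendsto_neg_atTop_atBot.comp tendsto_natCast_atTop_atTop)
  simpa [upperApprox] using h1.max h2

lemma toENNReal_upperApprox_le (n : ℕ) (a : EReal) :
    (upperApprox n a).toENNReal ≤ a.toENNReal + ENNReal.ofReal (1 / ((n : ℝ) + 1)) := by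
  rcases max_choice (a + ((1 / ((n : ℝ) + 1) : ℝ) : EReal)) ((-(n : ℝ) : ℝ) : EReal) with h | h
  · rw [upperApprox, h]
    exact EReal.toENNReal_add_le
  · rw [upperApprox, h, EReal.toENNReal_of_nonpos]
    · exact zero_le
    · exact EReal.coe_nonpos.2 (neg_nonpos.2 n.cast_nonneg)

/-- The positive parts exceed that of `f` by at most `1/(n+1)`, and the negative parts increase to
that of `f`, so monotone convergence applies. Finiteness of the positive integral keeps the
difference continuous even if the negative one is infinite. -/
lemma le_expectation_of_le_expectation_upperApprox {Ω : Type*} {mΩ : MeasurableSpace Ω}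
    {μ : Measure Ω} [IsFiniteMeasure μ] {f : Ω → EReal} (hf : AEMeasurable f μ)
    (hfin : ∫⁻ ω, (f ω).toENNReal ∂μ ≠ ∞) {c : EReal}
    (hc : ∀ n, c ≤ expectation μ (fun ω => upperApprox n (f ω))) : c ≤ expectation μ f := by
  have hpos : Tendsto (fun n : ℕ => ∫⁻ ω, (f ω).toENNReal ∂μ +
      ENNReal.ofReal (1 / ((n : ℝ) + 1)) * μ univ) atTop (𝓝 (∫⁻ ω, (f ω).toENNReal ∂μ)) := by
    have h0 : Tendsto (fun n : ℕ => ENNReal.ofReal (1 / ((n : ℝ) + 1))) atTop (𝓝 0) := by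
      simpa using ENNReal.tendsto_ofReal (tendsto_one_div_add_atTop_nhds_zero_nat (𝕜 := ℝ))
    simpa using tendsto_const_nhds.add
      (ENNReal.Tendsto.mul_const h0 (.inr (measure_ne_top μ univ)))
  have hneg : Tendsto (fun n : ℕ => ∫⁻ ω, (-upperApprox n (f ω)).toENNReal ∂μ) atTop
      (𝓝 (∫⁻ ω, (-f ω).toENNReal ∂μ)) := by
    refine lintegral_tendsto_of_tendsto_of_monotone
      (fun n => ((measurable_upperApprox n).comp_aemeasurable hf).neg.ereal_toENNReal)
      (.of_forall fun ω m n hmn => EReal.toENNReal_le_toENNReal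
        (EReal.neg_le_neg_iff.2 (antitone_upperApprox _ hmn))) (.of_forall fun ω => ?_)
    exact (EReal.continuous_toENNReal.comp continuous_neg).continuousAt.tendsto.comp
      (tendsto_upperApprox (f ω))
  have hlim : Tendsto (fun n : ℕ => ((∫⁻ ω, (f ω).toENNReal ∂μ +
      ENNReal.ofReal (1 / ((n : ℝ) + 1)) * μ univ : ℝ≥0∞) : EReal) -
        ((∫⁻ ω, (-upperApprox n (f ω)).toENNReal ∂μ : ℝ≥0∞) : EReal)) atTop
      (𝓝 (expectation μ f)) := by
    simp only [expectation, sub_eq_add_neg]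
    refine (EReal.continuousAt_add (p := (_, _)) (.inl ?_) (.inl ?_)).tendsto.comp
      (Tendsto.prodMk_nhds ((continuous_coe_ennreal_ereal.tendsto _).comp hpos)
        ((continuous_neg.tendsto _).comp ((continuous_coe_ennreal_ereal.tendsto _).comp hneg)))
    · simpa using hfin
    · simp
  refine ge_of_tendsto' hlim fun n => (hc n).trans ?_
  refine EReal.sub_le_sub (EReal.coe_ennreal_le_coe_ennreal_iff.2 ?_) le_rfl
  refine (lintegral_mono fun ω => toENNReal_upperApprox_le n (f ω)).trans_eq ?_
  rw [lintegral_add_right _ measurable_const, lintegral_const]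

lemma IsCondExp.expectation_eq {Ω : Type*} {m mΩ : MeasurableSpace Ω} {μ : Measure Ω}
    {f φ : Ω → EReal} (h : IsCondExp m μ f φ) : expectation μ φ = expectation μ f := by
  simpa using h.setExpectation_eq univ MeasurableSet.univ

lemma IsCondExp.expectationExists {Ω : Type*} {m mΩ : MeasurableSpace Ω} {μ : Measure Ω}
    {f φ : Ω → EReal} (h : IsCondExp m μ f φ) : ExpectationExists μ φ := by
  simpa using h.exists_setExpectation univ MeasurableSet.univ

end FundLemma

/-! ### Interchange of minimization and expectation -/

open FundLemma in
theorem mainTheorem1 {Ω : Type*} [mΩ : MeasurableSpace Ω] (P : Measure Ω) [IsProbabilityMeasure P]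
    {M N : ℕ}
    (Y : Ω → EuclideanSpace ℝ (Fin M)) (hY : Measurable Y)
    (g : Ω → EuclideanSpace ℝ (Fin N) → ℝ)
    (hg : ∀ x, FundLemma.ExpectationExists P (fun ω => (g ω x : EReal)))
    (ce : Ω → EuclideanSpace ℝ (Fin N) → EReal)
    (hce : ∀ x, FundLemma.IsCondExp (FundLemma.sigmaAlg Y) P
      (fun ω => (g ω x : EReal)) (fun ω => ce ω x))
    (𝒳 : EuclideanSpace ℝ (Fin N) → Set (EuclideanSpace ℝ (Fin N)))
    (h𝒳closed : ∀ z, IsClosed (𝒳 z))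
    (h𝒳meas : FundLemma.MeasurableMulti 𝒳)
    (h𝒳dom : FundLemma.multiDom 𝒳 = Set.univ)
    (Z : Ω → EuclideanSpace ℝ (Fin N))
    (hZ : ∃ 𝒵 : EuclideanSpace ℝ (Fin M) → EuclideanSpace ℝ (Fin N),
      Measurable 𝒵 ∧ ∀ ω, Z ω = 𝒵 (Y ω)) :
    (FundLemma.decisionSet P Y 𝒳 Z).Nonempty ∧
    ((∀ X ∈ FundLemma.decisionSet P Y 𝒳 Z,
        FundLemma.ExpectationExists P (fun ω => (g ω (X ω) : EReal))) →
      (⨅ X ∈ FundLemma.decisionSet P Y 𝒳 Z,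
        FundLemma.expectation P (fun ω => (g ω (X ω) : EReal))) < ⊤ →
      FundLemma.SubstitutionProperty P Y g ce (FundLemma.decisionSet P Y 𝒳 Z) →
      -- measurability for the completion of `σ(Y)` relative to the restriction of `P` to `σ(Y)`
      @NullMeasurable Ω EReal (FundLemma.sigmaAlg Y) _ (FundLemma.optimalValue ce 𝒳 Z)
        (P.trim hY.comap_le) ∧
      FundLemma.ExpectationExists P (FundLemma.optimalValue ce 𝒳 Z) ∧
      (⨅ X ∈ FundLemma.decisionSet P Y 𝒳 Z,
          FundLemma.expectation P (fun ω => (g ω (X ω) : EReal))) =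
        FundLemma.expectation P (FundLemma.optimalValue ce 𝒳 Z)) := by
  obtain ⟨𝒵, h𝒵, hZY⟩ := hZ
  have hprob : IsProbabilityMeasure (P.map Y) := Measure.isProbabilityMeasure_map hY.aemeasurable
  have hYc : Measurable[sigmaAlg Y] Y := comap_measurable Y
  have hgraph : MeasurableSet {q : EuclideanSpace ℝ (Fin M) × EuclideanSpace ℝ (Fin N) |
      q.2 ∈ 𝒳 (𝒵 q.1)} :=
    ((h𝒵.comp measurable_fst).prodMk measurable_snd)
      (h𝒳meas.measurableSet_graph h𝒳closed)
  have hsel : ∀ s : EuclideanSpace ℝ (Fin M) → EuclideanSpace ℝ (Fin N), Measurable s →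
      (∀ᵐ ω ∂P, s (Y ω) ∈ 𝒳 (𝒵 (Y ω))) → s ∘ Y ∈ decisionSet P Y 𝒳 Z := fun s hs hsP =>
    ⟨by simpa only [hZY, Function.comp_apply] using hsP, hs.comp hYc⟩
  refine ⟨?_, fun hex hlt hsub => ?_⟩
  · obtain ⟨s, hs, hsP⟩ := exists_measurable_ae_selection (P.map Y) hgraph
    refine ⟨s ∘ Y, hsel s hs ?_⟩
    filter_upwards [ae_of_ae_map hY.aemeasurable hsP] with ω hω
    exact hω (h𝒳dom.symm ▸ Set.mem_univ (𝒵 (Y ω)) : 𝒵 (Y ω) ∈ multiDom 𝒳)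
  obtain ⟨-, h, hh, hhce, hcond⟩ := hsub
  let θ : EuclideanSpace ℝ (Fin M) → EReal := fun y => ⨅ x ∈ 𝒳 (𝒵 y), h (y, x)
  have hopt : optimalValue ce 𝒳 Z = θ ∘ Y := by
    funext ω
    simp only [optimalValue, θ, Function.comp_apply, hZY, hhce]
  have hθ : NullMeasurable θ (P.map Y) := nullMeasurable_biInf (P.map Y) hgraph hh
  have hle : ∀ X ∈ decisionSet P Y 𝒳 Z, ∀ᵐ ω ∂P, θ (Y ω) ≤ h (Y ω, X ω) := by
    intro X hX
    filter_upwards [hX.1] with ω hω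
    rw [hZY] at hω
    exact iInf₂_le (X ω) hω
  rw [hopt]
  have hθY : AEMeasurable (θ ∘ Y) P := hθ.aemeasurable.comp_measurable hY
  -- A decision of expected cost below `⊤` dominates `ϑ` and has finite positive part.
  have hfin : ∫⁻ ω, ((θ ∘ Y) ω).toENNReal ∂P ≠ ∞ := by
    simp only [iInf_lt_iff] at hlt
    obtain ⟨X, hX, hXlt⟩ := hlt
    have hXc := hcond X hX
    rw [← hXc.expectation_eq] at hXlt
    refine ne_top_of_le_ne_top
      (lintegral_toENNReal_ne_top_of_expectation_lt_top hXc.expectationExists hXlt)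
      (lintegral_mono_ae ?_)
    filter_upwards [hle X hX] with ω hω using EReal.toENNReal_le_toENNReal hω
  refine ⟨nullMeasurable_comp_trim P hY.comap_le hYc hθ, ⟨hθY, .inl hfin⟩, le_antisymm ?_ ?_⟩
  · refine le_expectation_of_le_expectation_upperApprox hθY hfin fun n => ?_
    -- `θ` is only universally measurable; an almost everywhere equal Borel version makes the set of
    -- near-minimizers Borel.
    obtain ⟨θ', hθ', hθθ'⟩ := hθ.aemeasurable
    have hB := hgraph.inter (measurableSet_lt hh
      ((measurable_upperApprox n).comp (hθ'.comp measurable_fst)))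
    obtain ⟨s, hs, hsB⟩ := exists_measurable_ae_selection (P.map Y) hB
    have hsP : ∀ᵐ ω ∂P, s (Y ω) ∈ 𝒳 (𝒵 (Y ω)) ∧
        h (Y ω, s (Y ω)) < upperApprox n (θ (Y ω)) := by
      -- Finiteness of the positive integral gives `θ (Y ω) < ⊤` almost everywhere, without which no
      -- strict upper bound, hence no near-minimizer, would exist.
      filter_upwards [ae_of_ae_map hY.aemeasurable hsB, ae_of_ae_map hY.aemeasurable hθθ',
        ae_lt_top' hθY.ereal_toENNReal hfin] with ω hω hω' hωtop
      have hlt' : θ (Y ω) < upperApprox n (θ (Y ω)) :=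
        lt_upperApprox n (lt_top_iff_ne_top.2 (EReal.toENNReal_ne_top_iff.1 hωtop.ne))
      obtain ⟨x, hx, hxlt⟩ := (by simpa only [θ, iInf_lt_iff] using hlt' :
        ∃ x, ∃ _ : x ∈ 𝒳 (𝒵 (Y ω)), h (Y ω, x) < upperApprox n (θ (Y ω)))
      rw [hω'] at hxlt ⊢
      exact hω ⟨x, hx, hxlt⟩
    have hmem := hsel s hs (hsP.mono fun ω hω => hω.1)
    refine (iInf₂_le (s ∘ Y) hmem).trans ?_
    rw [← (hcond _ hmem).expectation_eq]
    exact expectation_mono_ae (hsP.mono fun ω hω => hω.2.le)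
  · refine le_iInf₂ fun X hX => ?_
    rw [← (hcond X hX).expectation_eq]
    exact expectation_mono_ae (hle X hX)
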